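/- Let $G$ and $G'$ be commutative groups, written additively. For $p\colon G\to G'$ and $a\in G$ put $(D_a p)(b)=p(a+b)-p(b)$. Call $p$ a polynomial mapping of degree $\le 0$ if it is constant, and, for $d\ge 1$, a polynomial mapping of degree $\le d$ if $D_a p$ is a polynomial mapping of degree $\le d-1$ for every $a\in G$; call $p$ a polynomial mapping if it is one of degree $\le d$ for some $d\ge 0$. The IP-set generated by a sequence $(u_j)_{j\in\mathbb N}$ in $G$ is the set $\{\sum_{j\in\gamma}u_j : \gamma\subset\mathbb N,\ 0<|\gamma|<\infty\}$; a subset of $G$ is an IP*-set if it has nonempty intersection with every IP-set in $G$. Corollary 8.8. Let $p_1,\dots,p_k\colon G\to G'$ be polynomial mappings with $p_1(0)=\dots=p_k(0)=0$. For any finite coloring $\chi\colon G'\to\{1,\dots,r\}$ there is an $l$, $1\le l\le r$, such that the set $$R=\{g\in G : \text{there is } h\in G' \text{ such that } \chi(h+p_i(g))=l \text{ for all } i=1,\dots,k\}$$ is an IP*-set in $G$. -/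

import Mathlib

/-- `p : G → G'` is a polynomial mapping of degree `≤ d` between commutative groups: for `d = 0`
it is constant; for `d + 1`, every difference `b ↦ p (b + a) - p b`, `a ∈ G`, is a polynomial
mapping of degree `≤ d`. -/
def IsPolyMapOfDegreeLE {G G' : Type*} [AddCommGroup G] [AddCommGroup G'] :
    ℕ → (G → G') → Prop
  | 0, p => ∃ c : G', ∀ x : G, p x = c
  | d + 1, p => ∀ a : G, IsPolyMapOfDegreeLE d (fwdDiff a p)

/-- `p` is a polynomial mapping if it is one of degree `≤ d` for some `d`. -/
def IsPolyMap {G G' : Type*} [AddCommGroup G] [AddCommGroup G'] (p : G → G') : Prop :=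
  ∃ d : ℕ, IsPolyMapOfDegreeLE d p

/-- The IP-set generated by the sequence `u`: all finite nonempty sums of terms of `u` with
distinct indices. -/
def ipSet {G : Type*} [AddCommMonoid G] (u : ℕ → G) : Set G :=
  {x | ∃ γ : Finset ℕ, γ.Nonempty ∧ x = ∑ j ∈ γ, u j}

/-- `E` is an IP*-set if it has nonempty intersection with every IP-set. -/
def IsIPStar {G : Type*} [AddCommMonoid G] (E : Set G) : Prop :=
  ∀ u : ℕ → G, (E ∩ ipSet u).Nonempty

/-!
The proof is polynomial exhaustion combined with color focusing. Let `A` be a finite family of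
polynomial mappings vanishing at `0`, and let `q` represent a class of `A`, modulo mappings of
smaller degree, of least degree. If the mappings `g ↦ p (a + g) - p a - q g` with `p ∈ A` and `a`
in a finite set are recurrent for every finite coloring, then a focus of `A` with `s` colors can be
extended by one color, and after as many steps as there are colors `A` itself is recurrent. Passing
to the new mappings replaces the class of `q` by finitely many classes of smaller degree and keeps
the degrees of the other classes, so it terminates by the multiset order.

A family of IP-sets, one for each color, is a single IP-set in a power of `G`. If the set of each
color `l` missed some IP-set, recurrence along the product of these IP-sets, applied to the mappings
`v ↦ p i (v l)` for all `i` and `l`, would give `h` and `v` with `χ (h + p i (v l)) = χ h` for all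
`i` and `l`; taking `l = χ h` contradicts the choice of the `l`-th IP-set.
-/

section PolynomialMappings

variable {G G' : Type*} [AddCommGroup G] [AddCommGroup G']

theorem isPolyMapOfDegreeLE_const (d : ℕ) (c : G') :
    IsPolyMapOfDegreeLE d (fun _ : G => c) := by
  induction d generalizing c with
  | zero => exact ⟨c, fun _ => rfl⟩
  | succ d ih =>
    intro a
    rw [fwdDiff_const]
    exact ih 0

theorem IsPolyMapOfDegreeLE.sub {d : ℕ} {p q : G → G'} (hp : IsPolyMapOfDegreeLE d p)
    (hq : IsPolyMapOfDegreeLE d q) : IsPolyMapOfDegreeLE d (p - q) := by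
  induction d generalizing p q with
  | zero =>
    obtain ⟨b, hb⟩ := hp
    obtain ⟨c, hc⟩ := hq
    exact ⟨b - c, fun x => by rw [Pi.sub_apply, hb, hc]⟩
  | succ d ih =>
    intro a
    have fwdDiff_sub : fwdDiff a (p - q) = fwdDiff a p - fwdDiff a q :=
      funext fun b => sub_sub_sub_comm _ _ _ _
    rw [fwdDiff_sub]
    exact ih (hp a) (hq a)

theorem IsPolyMapOfDegreeLE.succ {d : ℕ} {p : G → G'} (hp : IsPolyMapOfDegreeLE d p) :
    IsPolyMapOfDegreeLE (d + 1) p := by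
  induction d generalizing p with
  | zero =>
    obtain ⟨c, hc⟩ := hp
    obtain rfl : p = fun _ => c := funext hc
    exact isPolyMapOfDegreeLE_const 1 c
  | succ d ih => exact fun a => ih (hp a)

theorem IsPolyMapOfDegreeLE.comp_addMonoidHom {H : Type*} [AddCommGroup H] {d : ℕ} {p : G → G'}
    (hp : IsPolyMapOfDegreeLE d p) (f : H →+ G) : IsPolyMapOfDegreeLE d (p ∘ f) := by
  induction d generalizing p with
  | zero =>
    obtain ⟨c, hc⟩ := hp
    exact ⟨c, fun x => hc (f x)⟩
  | succ d ih =>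
    intro a
    have fwdDiff_comp : fwdDiff a (p ∘ f) = fwdDiff (f a) p ∘ f := by
      funext b
      simp only [fwdDiff, Function.comp_apply, map_add]
    rw [fwdDiff_comp]
    exact ih (hp (f a))

variable (G G') in
/-- The group of polynomial mappings of degree `≤ d` that vanish at `0`. The normalization makes
it trivial for `d = 0`. -/
def normalizedPolyMaps (d : ℕ) : AddSubgroup (G → G') :=
  AddSubgroup.ofSub {p | IsPolyMapOfDegreeLE d p ∧ p 0 = 0}
    ⟨0, isPolyMapOfDegreeLE_const d 0, rfl⟩
    fun p hp q hq => by
      rw [← sub_eq_add_neg]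
      exact ⟨hp.1.sub hq.1, by rw [Pi.sub_apply, hp.2, hq.2, sub_zero]⟩

theorem mem_normalizedPolyMaps {d : ℕ} {p : G → G'} :
    p ∈ normalizedPolyMaps G G' d ↔ IsPolyMapOfDegreeLE d p ∧ p 0 = 0 :=
  Iff.rfl

theorem normalizedPolyMaps_zero : normalizedPolyMaps G G' 0 = ⊥ := by
  refine (AddSubgroup.eq_bot_iff_forall _).2 fun p hp => ?_
  obtain ⟨⟨c, hc⟩, hp0⟩ := hp
  funext x
  rw [hc, ← hc 0, hp0, Pi.zero_apply]

theorem normalizedPolyMaps_mono : Monotone (normalizedPolyMaps G G') :=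
  monotone_nat_of_le_succ fun _ _ hp => ⟨hp.1.succ, hp.2⟩

/-- The mapping `p` recentered at `a`: its increment from `a`, as a function of the step. -/
def increment (a : G) (p : G → G') : G → G' := fun g => p (a + g) - p a

theorem increment_sub_mem {d : ℕ} {p q : G → G'} (hp : p ∈ normalizedPolyMaps G G' (d + 1))
    (hpq : p - q ∈ normalizedPolyMaps G G' d) (a : G) :
    increment a p - q ∈ normalizedPolyMaps G G' d := by
  have increment_sub_self : increment a p - p = fwdDiff a p - fun _ => p a := by
    funext g
    simp only [increment, fwdDiff, Pi.sub_apply, add_comm a g]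
    abel
  have hself : increment a p - p ∈ normalizedPolyMaps G G' d := by
    refine ⟨?_, by simp [increment, hp.2]⟩
    rw [increment_sub_self]
    exact (hp.1 a).sub (isPolyMapOfDegreeLE_const d (p a))
  simpa only [sub_add_sub_cancel] using add_mem hself hpq

end PolynomialMappings

section InitialSums

variable {G : Type*} [AddCommMonoid G]

/-- The part of the IP-set generated by `u` that only involves `u 0, …, u (N - 1)`. -/
def initialIPSet (u : ℕ → G) (N : ℕ) : Set G :=
  {x | ∃ γ ⊆ Finset.range N, γ.Nonempty ∧ x = ∑ j ∈ γ, u j}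

theorem initialIPSet_subset_ipSet (u : ℕ → G) (N : ℕ) : initialIPSet u N ⊆ ipSet u :=
  fun _ ⟨γ, _, hγ⟩ => ⟨γ, hγ⟩

theorem finite_initialIPSet (u : ℕ → G) (N : ℕ) : (initialIPSet u N).Finite := by
  refine ((Finset.range N).powerset.finite_toSet.image fun γ => ∑ j ∈ γ, u j).subset ?_
  rintro x ⟨γ, hγ, -, rfl⟩
  exact ⟨γ, Finset.mem_coe.2 (Finset.mem_powerset.2 hγ), rfl⟩

theorem initialIPSet_mono (u : ℕ → G) : Monotone (initialIPSet u) :=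
  fun _ _ h _ ⟨γ, hγ, hx⟩ => ⟨γ, hγ.trans (Finset.range_mono h), hx⟩

theorem exists_sum_eq_of_mem_insert_initialIPSet {u : ℕ → G} {N : ℕ} {a : G}
    (ha : a ∈ insert 0 (initialIPSet u N)) : ∃ γ ⊆ Finset.range N, a = ∑ j ∈ γ, u j := by
  rcases ha with rfl | ⟨γ, hγ, -, hsum⟩
  · exact ⟨∅, Finset.empty_subset _, Finset.sum_empty.symm⟩
  · exact ⟨γ, hγ, hsum⟩

theorem add_mem_initialIPSet {u : ℕ → G} {N M : ℕ} {a g : G}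
    (ha : a ∈ insert 0 (initialIPSet u N)) (hg : g ∈ initialIPSet (fun j => u (N + j)) M) :
    a + g ∈ initialIPSet u (N + M) := by
  obtain ⟨γ, hγ, rfl⟩ := exists_sum_eq_of_mem_insert_initialIPSet ha
  obtain ⟨δ, hδ, hδne, rfl⟩ := hg
  have hdisj : Disjoint γ (δ.map (addLeftEmbedding N)) :=
    (Finset.disjoint_range_addLeftEmbedding N δ).mono_left hγ
  refine ⟨γ.disjUnion _ hdisj, ?_, ?_, ?_⟩
  · rw [Finset.disjUnion_eq_union, Finset.range_add]
    exact Finset.union_subset_union hγ (Finset.map_subset_map.2 hδ)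
  · rw [Finset.disjUnion_eq_union]
    exact hδne.map.mono Finset.subset_union_right
  · rw [Finset.sum_disjUnion, Finset.sum_map]
    rfl

end InitialSums

section ColorFocusing

open scoped Pointwise

variable {G G' κ : Type*} [AddCommGroup G']

/-- The coloring `χ` is constant on some configuration `{h} ∪ {h + p g : p ∈ A}` with `h ∈ F` and
`g ∈ S`. -/
def HasRecurrence (χ : G' → κ) (A : Set (G → G')) (F : Set G') (S : Set G) : Prop :=
  ∃ h ∈ F, ∃ g ∈ S, ∀ p ∈ A, χ (h + p g) = χ h

/-- Each color in `C` is the color of a configuration `{x + p g : p ∈ A}` with `g ∈ S`; the color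
of the common focus `x` is unrestricted. -/
def IsFocusedAt (χ : G' → κ) (A : Set (G → G')) (S : Set G) (x : G') (C : Set κ) : Prop :=
  ∀ c ∈ C, ∃ g ∈ S, ∀ p ∈ A, χ (x + p g) = c

theorem HasRecurrence.of_translate {χ : G' → κ} {A : Set (G → G')} {F F' : Set G'} {S T : Set G}
    {y : G'} (h : HasRecurrence (fun z => χ (y + z)) A F S) (hF : ∀ x ∈ F, y + x ∈ F')
    (hST : S ⊆ T) : HasRecurrence χ A F' T := by
  obtain ⟨x, hx, g, hg, hχ⟩ := h
  exact ⟨y + x, hF x hx, g, hST hg, fun p hp => by rw [add_assoc]; exact hχ p hp⟩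

theorem IsFocusedAt.hasRecurrence {χ : G' → κ} {A : Set (G → G')} {F : Set G'} {S : Set G}
    {x : G'} {C : Set κ} (h : IsFocusedAt χ A S x C) (hx : x ∈ F) (hC : χ x ∈ C) :
    HasRecurrence χ A F S :=
  ⟨x, hx, h _ hC⟩

variable [AddCommGroup G]

/-- Every finite coloring is recurrent for `A` along every IP-set, within finite sets that depend on
the number of colors and the IP-set but not on the coloring. -/
def IsIPRecurrent (A : Set (G → G')) : Prop :=
  ∀ (r : ℕ) (u : ℕ → G), ∃ (N : ℕ) (F : Set G'), F.Finite ∧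
    ∀ χ : G' → Fin r, HasRecurrence χ A F (initialIPSet u N)

/-- The mappings to which color focusing reduces the recurrence of `A`. -/
def focusingFamily (D : Set G) (A : Set (G → G')) (q : G → G') : Set (G → G') :=
  Set.image2 (fun a p => increment a p - q) D A

theorem IsFocusedAt.insert_color {χ : G' → κ} {A : Set (G → G')} (hA : ∀ p ∈ A, p 0 = 0)
    {q : G → G'} {S T : Set G} {x y : G'} {g : G} {C : Set κ}
    (h : IsFocusedAt (fun z => χ (y + z)) A S x C)
    (hχ : ∀ a ∈ insert 0 S, ∀ p ∈ A,
      χ (y + (increment a p - q) g + (x + p a)) = χ (y + (x + p a)))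
    (hT : ∀ a ∈ insert 0 S, a + g ∈ T) :
    IsFocusedAt χ A T (y + x - q g) (insert (χ (y + x)) C) := by
  -- From the new focus, the step `a + g` leads to `y + (x + p a)`, displaced by a value of
  -- `increment a p - q` that the coloring does not see.
  have refocus : ∀ a ∈ insert 0 S, ∀ p ∈ A,
      χ (y + x - q g + p (a + g)) = χ (y + (x + p a)) := by
    intro a ha p hp
    rw [← hχ a ha p hp]
    congr 1
    simp only [increment, Pi.sub_apply]
    abel
  rintro c (rfl | hc)
  · refine ⟨0 + g, hT 0 (Set.mem_insert _ _), fun p hp => ?_⟩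
    rw [refocus 0 (Set.mem_insert _ _) p hp, hA p hp, add_zero]
  · obtain ⟨a, ha, hac⟩ := h c hc
    refine ⟨a + g, hT a (Set.mem_insert_of_mem _ ha), fun p hp => ?_⟩
    exact (refocus a (Set.mem_insert_of_mem _ ha) p hp).trans (hac p hp)

theorem isIPRecurrent_empty : IsIPRecurrent (∅ : Set (G → G')) :=
  fun _ u => ⟨1, {0}, Set.finite_singleton 0, fun _ =>
    ⟨0, rfl, u 0, ⟨{0}, by simp, Finset.singleton_nonempty 0, by simp⟩, by simp⟩⟩

theorem IsIPRecurrent.of_sdiff_zero {A : Set (G → G')} (h : IsIPRecurrent (A \ {0})) :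
    IsIPRecurrent A := by
  intro r u
  obtain ⟨N, F, hF, hrec⟩ := h r u
  refine ⟨N, F, hF, fun χ => ?_⟩
  obtain ⟨x, hx, g, hg, hχ⟩ := hrec χ
  refine ⟨x, hx, g, hg, fun p hp => ?_⟩
  by_cases hp0 : p = 0
  · rw [hp0, Pi.zero_apply, add_zero]
  · exact hχ p ⟨hp, hp0⟩

theorem IsIPRecurrent.exists_hasRecurrence {A : Set (G → G')} (h : IsIPRecurrent A)
    (κ : Type*) [Finite κ] (u : ℕ → G) : ∃ (N : ℕ) (F : Set G'), F.Finite ∧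
      ∀ χ : G' → κ, HasRecurrence χ A F (initialIPSet u N) := by
  obtain ⟨r, ⟨e⟩⟩ := Finite.exists_equiv_fin κ
  obtain ⟨N, F, hF, hrec⟩ := h r u
  refine ⟨N, F, hF, fun χ => ?_⟩
  obtain ⟨x, hx, g, hg, hχ⟩ := hrec (e ∘ χ)
  exact ⟨x, hx, g, hg, fun p hp => e.injective (hχ p hp)⟩

theorem IsIPRecurrent.exists_forall_translate {A : Set (G → G')} (h : IsIPRecurrent A)
    (κ : Type*) [Finite κ] {E : Set G'} (hE : E.Finite) (u : ℕ → G) :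
    ∃ (N : ℕ) (F : Set G'), F.Finite ∧ ∀ χ : G' → κ, ∃ y ∈ F, ∃ g ∈ initialIPSet u N,
      ∀ p ∈ A, ∀ z ∈ E, χ (y + p g + z) = χ (y + z) := by
  have := hE.to_subtype
  obtain ⟨N, F, hF, hrec⟩ := h.exists_hasRecurrence (E → κ) u
  refine ⟨N, F, hF, fun χ => ?_⟩
  obtain ⟨y, hy, g, hg, hχ⟩ := hrec fun y z => χ (y + z)
  exact ⟨y, hy, g, hg, fun p hp z hz => congrFun (hχ p hp) ⟨z, hz⟩⟩

theorem exists_hasRecurrence_or_isFocusedAt {A : Set (G → G')} (hA : A.Finite)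
    (hA0 : ∀ p ∈ A, p 0 = 0) {q : G → G'}
    (hq : ∀ D : Set G, D.Finite → IsIPRecurrent (focusingFamily D A q))
    (κ : Type*) [Finite κ] (u : ℕ → G) (s : ℕ) :
    ∃ (N : ℕ) (F : Set G'), F.Finite ∧ ∀ χ : G' → κ,
      HasRecurrence χ A F (initialIPSet u N) ∨
      ∃ x ∈ F, ∃ C : Set κ, C.ncard = s ∧ IsFocusedAt χ A (initialIPSet u N) x C := by
  induction s with
  | zero =>
    exact ⟨0, {0}, Set.finite_singleton 0, fun χ =>
      Or.inr ⟨0, rfl, ∅, Set.ncard_empty κ, fun _ hc => hc.elim⟩⟩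
  | succ s ih =>
    obtain ⟨N, F, hF, hfocus⟩ := ih
    have hD : (insert 0 (initialIPSet u N)).Finite := (finite_initialIPSet u N).insert 0
    obtain ⟨M, F', hF', hmono⟩ := (hq _ hD).exists_forall_translate κ
      (hF.add (hD.image2 (fun a p => p a) hA)) fun j => u (N + j)
    refine ⟨N + M, (F' + F) ∪ (F' + F - q '' initialIPSet (fun j => u (N + j)) M),
      (hF'.add hF).union ((hF'.add hF).sub ((finite_initialIPSet _ M).image q)), fun χ => ?_⟩
    obtain ⟨y, hy, g, hg, hχ⟩ := hmono χ
    by_cases hrec : HasRecurrence (fun z => χ (y + z)) A F (initialIPSet u N)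
    · exact Or.inl (hrec.of_translate (fun x hx => Or.inl (Set.add_mem_add hy hx))
        (initialIPSet_mono u (Nat.le_add_right N M)))
    obtain ⟨x, hx, C, hCs, hC⟩ := (hfocus _).resolve_left hrec
    have hnew : χ (y + x) ∉ C := fun hmem => hrec (hC.hasRecurrence hx hmem)
    refine Or.inr ⟨y + x - q g, Or.inr ?_, insert (χ (y + x)) C,
      by rw [Set.ncard_insert_of_notMem hnew, hCs], hC.insert_color hA0 (fun a ha p hp => ?_)
        fun a ha => add_mem_initialIPSet ha hg⟩
    · exact Set.sub_mem_sub (Set.add_mem_add hy hx) (Set.mem_image_of_mem q hg)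
    · exact hχ _ (Set.mem_image2_of_mem ha hp) _
        (Set.add_mem_add hx (Set.mem_image2_of_mem ha hp))

theorem IsIPRecurrent.of_focusingFamily {A : Set (G → G')} (hA : A.Finite)
    (hA0 : ∀ p ∈ A, p 0 = 0) {q : G → G'}
    (hq : ∀ D : Set G, D.Finite → IsIPRecurrent (focusingFamily D A q)) : IsIPRecurrent A := by
  intro r u
  obtain ⟨N, F, hF, h⟩ := exists_hasRecurrence_or_isFocusedAt hA hA0 hq (Fin r) u (r + 1)
  refine ⟨N, F, hF, fun χ => (h χ).resolve_right ?_⟩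
  rintro ⟨x, -, C, hC, -⟩
  have hle : C.ncard ≤ r := by simpa using Set.ncard_le_card C
  omega

end ColorFocusing

section PolynomialExhaustion

variable {G G' : Type*} [AddCommGroup G] [AddCommGroup G']

/-- A cover of `A` by classes modulo polynomial mappings of smaller degree. A pair `(w, d)` in `L`
stands for the class of `w`, of degree `≤ d + 1`, modulo degree `≤ d`. -/
structure IsClassCover (A : Set (G → G')) (L : Multiset ((G → G') × ℕ)) : Prop where
  mem_normalizedPolyMaps : ∀ z ∈ L, z.1 ∈ normalizedPolyMaps G G' (z.2 + 1)
  exists_sub_mem : ∀ p ∈ A, ∃ z ∈ L, p - z.1 ∈ normalizedPolyMaps G G' z.2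

theorem IsClassCover.exists_class {A : Set (G → G')} {L : Multiset ((G → G') × ℕ)}
    (h : IsClassCover A L) {p : G → G'} (hp : p ∈ A) :
    ∃ z ∈ L, p ∈ normalizedPolyMaps G G' (z.2 + 1) ∧ p - z.1 ∈ normalizedPolyMaps G G' z.2 := by
  obtain ⟨z, hz, hpz⟩ := h.exists_sub_mem p hp
  refine ⟨z, hz, ?_, hpz⟩
  simpa only [sub_add_cancel] using
    add_mem (normalizedPolyMaps_mono z.2.le_succ hpz) (h.mem_normalizedPolyMaps z hz)

theorem exists_isClassCover_of_subset {B : Set (G → G')} (hB : B.Finite) {d : ℕ}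
    (hBd : B ⊆ normalizedPolyMaps G G' d) :
    ∃ L, IsClassCover (B \ {0}) L ∧ ∀ z ∈ L, z.2 < d := by
  cases d with
  | zero =>
    refine ⟨0, ⟨by simp, fun p hp => absurd ?_ hp.2⟩, by simp⟩
    simpa [normalizedPolyMaps_zero] using hBd hp.1
  | succ d =>
    refine ⟨hB.toFinset.val.map fun p => (p, d), ⟨?_, fun p hp => ?_⟩, by simp⟩
    · simpa using fun p hp => hBd hp
    · exact ⟨(p, d), Multiset.mem_map_of_mem _ (hB.mem_toFinset.2 hp.1), by simp⟩

theorem IsClassCover.exists_focusingFamily {A : Set (G → G')} (hA : A.Finite)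
    {x : (G → G') × ℕ} {L : Multiset ((G → G') × ℕ)} (h : IsClassCover A (x ::ₘ L))
    (hmin : ∀ z ∈ L, x.2 ≤ z.2) {D : Set G} (hD : D.Finite) :
    ∃ L', IsClassCover (focusingFamily D A x.1 \ {0}) L' ∧
      Relation.CutExpand (· < ·) (L'.map Prod.snd) ((x ::ₘ L).map Prod.snd) := by
  have hfin : (focusingFamily D A x.1).Finite := hD.image2 _ hA
  obtain ⟨low, hlow, hlt⟩ := exists_isClassCover_of_subset
    (hfin.inter_of_left (normalizedPolyMaps G G' x.2)) Set.inter_subset_right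
  have hx := h.mem_normalizedPolyMaps x (Multiset.mem_cons_self x L)
  refine ⟨L.map (fun z => (z.1 - x.1, z.2)) + low, ⟨fun z hz => ?_, ?_⟩, ?_⟩
  · rcases Multiset.mem_add.1 hz with hz | hz
    · obtain ⟨w, hw, rfl⟩ := Multiset.mem_map.1 hz
      exact sub_mem (h.mem_normalizedPolyMaps w (Multiset.mem_cons_of_mem hw))
        (normalizedPolyMaps_mono (Nat.succ_le_succ (hmin w hw)) hx)
    · exact hlow.mem_normalizedPolyMaps z hz
  · rintro _ ⟨⟨a, ha, p, hp, rfl⟩, hne⟩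
    obtain ⟨w, hw, hpd, hpw⟩ := h.exists_class hp
    have hincr := increment_sub_mem hpd hpw a
    rcases Multiset.mem_cons.1 hw with rfl | hwL
    · obtain ⟨z, hz, hpz⟩ :=
        hlow.exists_sub_mem _ ⟨⟨Set.mem_image2_of_mem ha hp, hincr⟩, hne⟩
      exact ⟨z, Multiset.mem_add.2 (Or.inr hz), hpz⟩
    · refine ⟨(w.1 - x.1, w.2),
        Multiset.mem_add.2 (Or.inl (Multiset.mem_map_of_mem _ hwL)), ?_⟩
      simpa only [sub_sub_sub_cancel_right] using hincr
  · refine ⟨low.map Prod.snd, x.2, Multiset.forall_mem_map_iff.2 hlt, ?_⟩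
    simp only [Multiset.map_add, Multiset.map_map, Function.comp_def,
      ← Multiset.singleton_add]
    abel

theorem IsClassCover.isIPRecurrent {A : Set (G → G')} (hA : A.Finite)
    {L : Multiset ((G → G') × ℕ)} (h : IsClassCover A L) : IsIPRecurrent A := by
  induction L using (InvImage.wf (Multiset.map Prod.snd)
    (WellFounded.cutExpand (wellFounded_lt (α := ℕ)))).induction generalizing A with
  | _ L ih =>
  rcases eq_or_ne L 0 with rfl | hL
  · have hempty : A = ∅ := Set.eq_empty_of_forall_notMem fun p hp => by
      simpa using h.exists_sub_mem p hp
    exact hempty ▸ isIPRecurrent_empty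
  · obtain ⟨x, hxL, hmin⟩ := Multiset.exists_min_image Prod.snd hL
    obtain ⟨L, rfl⟩ := Multiset.exists_cons_of_mem hxL
    have hA0 (p) (hp : p ∈ A) : p 0 = 0 := by
      obtain ⟨z, -, hpz, -⟩ := h.exists_class hp
      exact hpz.2
    refine .of_focusingFamily hA hA0 (q := x.1) fun D hD => .of_sdiff_zero ?_
    obtain ⟨L', hL', hcut⟩ := h.exists_focusingFamily hA
      (fun z hz => hmin z (Multiset.mem_cons_of_mem hz)) hD
    exact ih L' hcut (hD.image2 _ hA).sdiff hL'

theorem isIPRecurrent_range {ι : Type*} [Finite ι] {p : ι → G → G'}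
    (hp : ∀ i, IsPolyMap (p i)) (hp0 : ∀ i, p i 0 = 0) : IsIPRecurrent (Set.range p) := by
  have := Fintype.ofFinite ι
  choose d hd using hp
  refine IsClassCover.isIPRecurrent (Set.finite_range p)
    (L := Finset.univ.val.map fun i => (p i, d i)) ⟨?_, ?_⟩
  · simpa using fun i => mem_normalizedPolyMaps.2 ⟨(hd i).succ, hp0 i⟩
  · rintro _ ⟨i, rfl⟩
    exact ⟨(p i, d i), Multiset.mem_map_of_mem _ (Finset.mem_univ_val i), by simp⟩

theorem exists_mem_ipSet_forall_color_eq {ι κ : Type*} [Finite ι] [Finite κ] {p : ι → G → G'}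
    (hp : ∀ i, IsPolyMap (p i)) (hp0 : ∀ i, p i 0 = 0) (u : ℕ → G) (χ : G' → κ) :
    ∃ g ∈ ipSet u, ∃ h, ∀ i, χ (h + p i g) = χ h := by
  obtain ⟨N, F, -, hrec⟩ := (isIPRecurrent_range hp hp0).exists_hasRecurrence κ u
  obtain ⟨h, -, g, hg, hχ⟩ := hrec χ
  exact ⟨g, initialIPSet_subset_ipSet u N hg, h, Set.forall_mem_range.1 hχ⟩

end PolynomialExhaustion

theorem corollary8p8 {G G' : Type*} [AddCommGroup G] [AddCommGroup G'] {k : ℕ}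
    (p : Fin k → G → G') (hp : ∀ i, IsPolyMap (p i)) (hp0 : ∀ i, p i 0 = 0)
    {r : ℕ} (χ : G' → Fin r) :
    ∃ l : Fin r, IsIPStar {g : G | ∃ h : G', ∀ i, χ (h + p i g) = l} := by
  by_contra! hmiss
  simp only [IsIPStar, not_forall] at hmiss
  choose u hu using hmiss
  let P (t : Fin k × Fin r) : (Fin r → G) → G' := p t.1 ∘ Pi.evalAddMonoidHom _ t.2
  have hP (t) : IsPolyMap (P t) := (hp t.1).imp fun _ hd => hd.comp_addMonoidHom _
  obtain ⟨_, ⟨γ, hγ, rfl⟩, h, hχ⟩ :=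
    exists_mem_ipSet_forall_color_eq hP (fun t => hp0 t.1) (fun j l => u l j) χ
  refine hu (χ h) ⟨∑ j ∈ γ, u (χ h) j, ⟨h, fun i => ?_⟩, γ, hγ, rfl⟩
  simpa [P] using hχ (i, χ h)
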